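/- Let $\mathbf{C}\{z_1\}$ be the ring of convergent power series, $K$ its field of fractions and $v$ the $z_1$-adic valuation on $K$ (normalized by $v(z_1)=1$); $v$ extends uniquely to a $\mathbf{Q}$-valued valuation on every finite extension of $K$. Let $U\subset \mathbf{C}\{z_1\}[z_2]$ be the multiplicative monoid of the polynomials that are monic in $z_2$ and not divisible by $z_2$, and let $W\subset U$ be the submonoid of Weierstrass polynomials, i.e. of those $f\in U$ with $f(0,z_2)=z_2^{n}$, where $n=\deg_{z_2} f$. For $f=\sum c_{ij}z_1^iz_2^j\in\mathbf{C}\{z_1\}[z_2]$, the Newton polygon $N(f)$ is (the boundary of) the convex hull in $\mathbf{R}^2$ of $\bigcup_{c_{ij}\ne 0}\big((i,j)+\mathbf{N}^2\big)$. In general a Newton polygon is (the boundary of) the convex hull of $S+\mathbf{N}^2$ for a set $S\subset\mathbf{N}^2$. The sum of two Newton polygons is the convex hull of the set of all sums $p_1+p_2$ of points $p_1,p_2$ of the two convex regions; its neutral element is the quadrant $\mathbf{R}_{\ge 0}^2$. Let $NU$ be the additive monoid of the Newton polygons whose regions meet both coordinate axes. For $f,g\in U$ write $f\sim g$ if for every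 $\rho\in\mathbf{Q}$ and every finite Galois extension $L$ of $K$ over which $f$ and $g$ split, $f$ and $g$ have the same number (with multiplicity) of roots in $L$ of valuation $\rho$. Write $f\sim_+ g$ if this holds for every $\rho>0$. Then: 1. $\sim$ is a congruence on $W$, and $f\mapsto N(f)$ induces an isomorphism of monoids $W/{\sim}\to NU$. 2. $\sim$ is a congruence on $U$, and $f\mapsto N(f)$ induces a surjective homomorphism of monoids $U/{\sim}\to NU$. 3. $\sim_+$ is a congruence on $U$, and $f\mapsto N(f)$ induces an isomorphism of monoids $U/{\sim_+}\to NU$. -/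

import Mathlib

open scoped Pointwise PowerSeries

noncomputable section

/-! ### Newton polygons in the plane -/

/-- The set of all real points `A + B`, where `A ∈ S` and `B ∈ ℕ²`. -/
def latticeShadow (S : Set (ℕ × ℕ)) : Set (ℝ × ℝ) :=
  {p | ∃ A ∈ S, ∃ B : ℕ × ℕ, p = (((A.1 + B.1 : ℕ) : ℝ), ((A.2 + B.2 : ℕ) : ℝ))}

/-- The convex region cut out by the exponent set `S ⊆ ℕ²`: the convex hull of `S + ℕ²` in `ℝ²`. -/
def newtonRegion (S : Set (ℕ × ℕ)) : Set (ℝ × ℝ) :=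
  convexHull ℝ (latticeShadow S)

theorem latticeShadow_add (S T : Set (ℕ × ℕ)) :
    latticeShadow S + latticeShadow T = latticeShadow (S + T) := by
  ext p
  constructor
  · rintro ⟨_, ⟨A, hA, B, rfl⟩, _, ⟨A', hA', B', rfl⟩, rfl⟩
    refine ⟨A + A', Set.add_mem_add hA hA', B + B', ?_⟩
    simp only [Prod.mk_add_mk, Prod.fst_add, Prod.snd_add]
    push_cast
    ext <;> simp only [] <;> ring
  · rintro ⟨_, ⟨A, hA, A', hA', rfl⟩, B, rfl⟩
    refine ⟨_, ⟨A, hA, B, rfl⟩, _, ⟨A', hA', 0, rfl⟩, ?_⟩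
    simp only [Prod.mk_add_mk, Prod.fst_add, Prod.snd_add, Prod.fst_zero, Prod.snd_zero]
    push_cast
    ext <;> simp only [] <;> ring

theorem newtonRegion_add (S T : Set (ℕ × ℕ)) :
    convexHull ℝ (newtonRegion S + newtonRegion T) = newtonRegion (S + T) := by
  unfold newtonRegion
  rw [← convexHull_add, ← latticeShadow_add]
  exact (convex_convexHull ℝ _).convexHull_eq

/-- A Newton polygon, given by the convex region that it bounds: the convex hull of `S + ℕ²`, where
`S ⊆ ℕ²` is arbitrary (every `S` is the support of a formal power series in two variables; the zero
series gives the empty region). The first coordinate is the exponent of `z₁`, the second one the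
exponent of `z₂`. -/
@[ext]
structure NewtonPolygon where
  region : Set (ℝ × ℝ)
  exists_support : ∃ S : Set (ℕ × ℕ), region = newtonRegion S

namespace NewtonPolygon

/-- The sum of two Newton polygons: the convex hull of the set of all sums `p₁ + p₂`. -/
instance : Add NewtonPolygon where
  add M N :=
    { region := convexHull ℝ (M.region + N.region)
      exists_support := by
        obtain ⟨S, hS⟩ := M.exists_support
        obtain ⟨T, hT⟩ := N.exists_support
        exact ⟨S + T, by rw [hS, hT, newtonRegion_add]⟩ }

/-- The neutral Newton polygon: its region is the whole positive quadrant. -/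
instance : Zero NewtonPolygon where
  zero := ⟨newtonRegion {0}, {0}, rfl⟩

theorem region_add (M N : NewtonPolygon) :
    (M + N).region = convexHull ℝ (M.region + N.region) := rfl

theorem region_zero : (0 : NewtonPolygon).region = newtonRegion {0} := rfl

protected theorem add_comm (M N : NewtonPolygon) : M + N = N + M := by
  ext1
  rw [region_add, region_add, add_comm]

protected theorem zero_add (N : NewtonPolygon) : 0 + N = N := by
  obtain ⟨S, hS⟩ := N.exists_support
  ext1
  rw [region_add, region_zero, hS, newtonRegion_add, Set.singleton_zero, zero_add]

protected theorem add_assoc (M N P : NewtonPolygon) : M + N + P = M + (N + P) := by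
  obtain ⟨S, hS⟩ := M.exists_support
  obtain ⟨T, hT⟩ := N.exists_support
  obtain ⟨R, hR⟩ := P.exists_support
  ext1
  simp only [region_add, hS, hT, hR, newtonRegion_add, add_assoc]

instance : AddCommMonoid NewtonPolygon where
  add_assoc := NewtonPolygon.add_assoc
  zero_add := NewtonPolygon.zero_add
  add_zero N := by rw [NewtonPolygon.add_comm, NewtonPolygon.zero_add]
  add_comm := NewtonPolygon.add_comm
  nsmul := nsmulRec

/-- The monoid `NU` of the Newton polygons that meet both coordinate axes. -/
def NU : AddSubmonoid NewtonPolygon where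
  carrier := {N | (∃ x : ℝ, (x, 0) ∈ N.region) ∧ ∃ y : ℝ, (0, y) ∈ N.region}
  zero_mem' := by
    have h : ((0 : ℝ), (0 : ℝ)) ∈ (0 : NewtonPolygon).region :=
      subset_convexHull ℝ _ ⟨0, rfl, 0, by simp⟩
    exact ⟨⟨0, h⟩, ⟨0, h⟩⟩
  add_mem' := by
    rintro M N ⟨⟨x, hx⟩, y, hy⟩ ⟨⟨x', hx'⟩, y', hy'⟩
    refine ⟨⟨x + x', subset_convexHull ℝ _ ⟨_, hx, _, hx', ?_⟩⟩,
      ⟨y + y', subset_convexHull ℝ _ ⟨_, hy, _, hy', ?_⟩⟩⟩ <;> simp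

end NewtonPolygon

/-! ### Convergent power series and polynomials over them -/

/-- The ring `ℂ{z₁}` of power series with a positive radius of convergence. -/
def ConvergentSeries : Subring ℂ⟦X⟧ where
  carrier := {f | ∃ r : ℝ, 0 < r ∧ Summable fun n : ℕ => ‖PowerSeries.coeff n f‖ * r ^ n}
  zero_mem' := ⟨1, one_pos, by simp⟩
  one_mem' := by
    refine ⟨1, one_pos, summable_of_ne_finset_zero (s := {0}) fun n hn => ?_⟩
    have hn' : n ≠ 0 := by simpa using hn
    simp [PowerSeries.coeff_one, hn']
  neg_mem' := by
    rintro f ⟨r, hr, hf⟩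
    exact ⟨r, hr, by simpa using hf⟩
  add_mem' := by
    rintro f g ⟨r, hr, hf⟩ ⟨s, hs, hg⟩
    have hm : 0 < min r s := lt_min hr hs
    refine ⟨min r s, hm, Summable.of_nonneg_of_le (fun n => by positivity) (fun n => ?_)
      (hf.add hg)⟩
    calc ‖PowerSeries.coeff n (f + g)‖ * min r s ^ n
        ≤ (‖PowerSeries.coeff n f‖ + ‖PowerSeries.coeff n g‖) * min r s ^ n := by
          rw [map_add]
          gcongr
          exact norm_add_le _ _
      _ = ‖PowerSeries.coeff n f‖ * min r s ^ n + ‖PowerSeries.coeff n g‖ * min r s ^ n := by ring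
      _ ≤ ‖PowerSeries.coeff n f‖ * r ^ n + ‖PowerSeries.coeff n g‖ * s ^ n := by
          gcongr
          · exact min_le_left _ _
          · exact min_le_right _ _
  mul_mem' := by
    rintro f g ⟨r, hr, hf⟩ ⟨s, hs, hg⟩
    have hm : 0 < min r s := lt_min hr hs
    set t := min r s with ht
    have hf' : Summable fun n : ℕ => ‖PowerSeries.coeff n f * (t : ℂ) ^ n‖ := by
      refine Summable.of_nonneg_of_le (fun n => norm_nonneg _) (fun n => ?_) hf
      rw [norm_mul, norm_pow, Complex.norm_of_nonneg hm.le]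
      gcongr
      exact min_le_left _ _
    have hg' : Summable fun n : ℕ => ‖PowerSeries.coeff n g * (t : ℂ) ^ n‖ := by
      refine Summable.of_nonneg_of_le (fun n => norm_nonneg _) (fun n => ?_) hg
      rw [norm_mul, norm_pow, Complex.norm_of_nonneg hm.le]
      gcongr
      exact min_le_right _ _
    refine ⟨t, hm, (summable_norm_sum_mul_antidiagonal_of_summable_norm hf' hg').congr
      fun n => ?_⟩
    have h : ∑ kl ∈ Finset.HasAntidiagonal.antidiagonal n, PowerSeries.coeff kl.1 f * (t : ℂ) ^ kl.1 *
        (PowerSeries.coeff kl.2 g * (t : ℂ) ^ kl.2) = PowerSeries.coeff n (f * g) * (t : ℂ) ^ n := by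
      rw [PowerSeries.coeff_mul, Finset.sum_mul]
      refine Finset.sum_congr rfl fun kl hkl => ?_
      rw [← Finset.HasAntidiagonal.mem_antidiagonal.1 hkl, pow_add]
      ring
    rw [h, norm_mul, norm_pow, Complex.norm_of_nonneg hm.le]

/-- The field of fractions `K` of `ℂ{z₁}`. -/
abbrev ConvergentSeriesField : Type := FractionRing ConvergentSeries

/-- The monoid `U` of the monic polynomials in `z₂` over `ℂ{z₁}` that are not divisible by `z₂`. -/
def monicU : Submonoid (Polynomial ConvergentSeries) where
  carrier := {f | f.Monic ∧ ¬ Polynomial.X ∣ f}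
  one_mem' := ⟨Polynomial.monic_one, by simp [Polynomial.X_dvd_iff]⟩
  mul_mem' := by
    rintro f g ⟨hf, hf'⟩ ⟨hg, hg'⟩
    exact ⟨hf.mul hg, fun h => (Polynomial.prime_X.dvd_or_dvd h).elim hf' hg'⟩

/-- The polynomial `f(0, z₂)`. -/
def atZero (f : Polynomial ConvergentSeries) : Polynomial ℂ :=
  f.map ((PowerSeries.constantCoeff (R := ℂ)).comp ConvergentSeries.subtype)

/-- The monoid of the Weierstrass polynomials in `U`, that is, those `f` of some degree `n` in `z₂`
with `f(0, z₂) = z₂ ^ n`. -/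
def weierstrassU : Submonoid (Polynomial ConvergentSeries) where
  carrier := {f | f ∈ monicU ∧ atZero f = Polynomial.X ^ f.natDegree}
  one_mem' := ⟨monicU.one_mem, by simp [atZero]⟩
  mul_mem' := by
    rintro f g ⟨hf, hf'⟩ ⟨hg, hg'⟩
    refine ⟨monicU.mul_mem hf hg, ?_⟩
    rw [hf.1.natDegree_mul hg.1, pow_add, ← hf', ← hg', atZero, Polynomial.map_mul, atZero, atZero]

/-- The Newton polygon `N(f)`: its region is the convex hull of `Supp(f) + ℕ²`, where `(i, j)` lies
in `Supp(f)` if the monomial `z₁ ^ i * z₂ ^ j` has a nonzero coefficient in `f`. -/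
def newtonPolygon (f : Polynomial ConvergentSeries) : NewtonPolygon where
  region := newtonRegion {A | PowerSeries.coeff A.1 (f.coeff A.2 : ℂ⟦X⟧) ≠ 0}
  exists_support := ⟨_, rfl⟩

/-! ### Valuations of roots -/

/-- The rational-valued valuation `w` of the extension field `L` of `K` extends the `z₁`-adic
valuation: `w` is the order of vanishing in `z₁` on `ℂ{z₁}` (hence on `K`). -/
def ExtendsAdic {L : Type} [Field L] [Algebra ConvergentSeriesField L]
    (w : AddValuation L (WithTop ℚ)) : Prop :=
  ∀ a : ConvergentSeries,
    w (algebraMap ConvergentSeriesField L (algebraMap ConvergentSeries ConvergentSeriesField a)) =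
      WithTop.map (Nat.cast : ℕ → ℚ) (PowerSeries.order (a : ℂ⟦X⟧))

/-- The polynomial `f`, seen as a polynomial in `z₂` over the extension field `L` of `K`. -/
def overField (L : Type) [Field L] [Algebra ConvergentSeriesField L]
    (f : Polynomial ConvergentSeries) : Polynomial L :=
  f.map ((algebraMap ConvergentSeriesField L).comp
    (algebraMap ConvergentSeries ConvergentSeriesField))

/-- The number `m_ρ` of roots of `f` in `L`, counted with multiplicity, whose valuation is `ρ`. -/
def rootCount {L : Type} [Field L] [Algebra ConvergentSeriesField L]
    (w : AddValuation L (WithTop ℚ)) (f : Polynomial ConvergentSeries) (ρ : ℚ) : ℕ :=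
  ((overField L f).roots.map w).count (ρ : WithTop ℚ)

/-- In every finite Galois extension `L` of `K` over which `f` and `g` split, with the extension of
the `z₁`-adic valuation to `L`, the polynomials `f` and `g` have the same number of roots of
valuation `ρ`. -/
def SameRootCount (f g : Polynomial ConvergentSeries) (ρ : ℚ) : Prop :=
  ∀ (L : Type) [Field L] [Algebra ConvergentSeriesField L]
    [FiniteDimensional ConvergentSeriesField L] [IsGalois ConvergentSeriesField L]
    (w : AddValuation L (WithTop ℚ)), ExtendsAdic w →
    (overField L f).Splits → (overField L g).Splits → rootCount w f ρ = rootCount w g ρ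

/-- The relation `f ∼ g`: the same number of roots of each valuation. -/
def RootEquiv (f g : Polynomial ConvergentSeries) : Prop :=
  ∀ ρ : ℚ, SameRootCount f g ρ

/-- The same number of roots of each positive valuation. -/
def PosRootEquiv (f g : Polynomial ConvergentSeries) : Prop :=
  ∀ ρ : ℚ, 0 < ρ → SameRootCount f g ρ

end

/-!
For a positive rational `ρ`, the Gauss valuation `v_ρ(∑ a_j z₂ ^ j) = min_j (v(a_j) + ρ j)` is the
least weight `i + ρ j` of a point of the support of `f`. The region bounded by `N(f)` is an
intersection of half planes with rational normal vectors, so `N(f)` and the family of all `v_ρ(f)`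
determine each other. Multiplicativity of `v_ρ` (Gauss's lemma) therefore gives
`N(fg) = N(f) + N(g)`.

If `f` is monic with roots `α₁, …, αₙ`, applying `v_ρ` to `∏ (z₂ - αₖ)` yields
`v_ρ(f) = ∑ min(ρ, v(αₖ))`. This is piecewise linear in `ρ`, and its slope drops at each `ρ > 0` by
the number of roots of valuation `ρ`. So `N(f)` carries the same information as the numbers of roots
of positive valuation. As `f` has integral coefficients, the remaining roots have valuation `0`, and
their number is then known from the degree. A Weierstrass polynomial of degree `n` has `(0, n)` as
its only exponent on the vertical axis, so there the degree is already determined by `N(f)`.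

For surjectivity, a Newton polygon is spanned by a finite antichain of exponents. If that antichain
meets both axes, the sum of its monomials is a Weierstrass polynomial.
-/

section PowerSeriesInverse

open PowerSeries

theorem coeff_inv_eq_sum_range {k : Type*} [Field k] (f : k⟦X⟧) {n : ℕ} (hn : n ≠ 0) :
    coeff n f⁻¹ =
      -(constantCoeff f)⁻¹ * ∑ i ∈ Finset.range n, coeff (n - i) f * coeff i f⁻¹ := by
  rw [coeff_inv, if_neg hn, ← Finset.Nat.sum_antidiagonal_swap]
  simp only [Prod.fst_swap, Prod.snd_swap]
  rw [Finset.Nat.sum_antidiagonal_eq_sum_range_succ_mk, Finset.sum_range_succ,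
    if_neg (lt_irrefl n), add_zero]
  congr 1
  exact Finset.sum_congr rfl fun i hi => if_pos (Finset.mem_range.1 hi)

theorem norm_coeff_inv_le {𝕜 : Type*} [NormedField 𝕜] {f : 𝕜⟦X⟧} {C R : ℝ} (hR : 0 ≤ R)
    (hf : ∀ n, ‖coeff n f‖ ≤ C * R ^ n) (n : ℕ) :
    ‖coeff n f⁻¹‖ ≤
      ‖constantCoeff f‖⁻¹ * (R * (1 + C * ‖constantCoeff f‖⁻¹)) ^ n := by
  set b := ‖constantCoeff f‖⁻¹ with hb
  have : 0 ≤ b := by positivity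
  have hC : 0 ≤ C := (norm_nonneg _).trans (by simpa using hf 0)
  induction n using Nat.strong_induction_on with
  | _ n ih =>
  rcases eq_or_ne n 0 with rfl | hn
  · simp [hb]
  calc ‖coeff n f⁻¹‖
      ≤ b * ∑ i ∈ Finset.range n, ‖coeff (n - i) f‖ * ‖coeff i f⁻¹‖ := by
        rw [coeff_inv_eq_sum_range f hn, norm_mul, norm_neg, norm_inv]
        gcongr
        exact norm_sum_le_of_le _ fun i _ => (norm_mul _ _).le
    _ ≤ b * ∑ i ∈ Finset.range n, C * R ^ (n - i) * (b * (R * (1 + C * b)) ^ i) := by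
        gcongr with i hi
        · exact hf _
        · exact ih i (Finset.mem_range.1 hi)
    _ = b * R ^ n * ((∑ i ∈ Finset.range n, (1 + C * b) ^ i) * (1 + C * b - 1)) := by
        rw [Finset.sum_mul, Finset.mul_sum, Finset.mul_sum]
        refine Finset.sum_congr rfl fun i hi => ?_
        rw [mul_pow, ← Nat.sub_add_cancel (Finset.mem_range.1 hi).le, pow_add,
          Nat.sub_add_cancel (Finset.mem_range.1 hi).le]
        ring
    _ = b * R ^ n * ((1 + C * b) ^ n - 1) := by rw [geom_sum_mul]
    _ ≤ b * (R * (1 + C * b)) ^ n := by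
        rw [mul_pow, ← mul_assoc]
        gcongr
        exact sub_le_self _ zero_le_one

end PowerSeriesInverse

namespace ConvergentSeries

open PowerSeries

theorem mem_iff_norm_coeff_le {f : ℂ⟦X⟧} :
    f ∈ ConvergentSeries ↔ ∃ C R : ℝ, 0 < R ∧ ∀ n, ‖coeff n f‖ ≤ C * R ^ n := by
  constructor
  · rintro ⟨r, hr, hs⟩
    refine ⟨∑' n, ‖coeff n f‖ * r ^ n, r⁻¹, inv_pos.2 hr, fun n => ?_⟩
    rw [inv_pow, ← div_eq_mul_inv, le_div_iff₀ (by positivity)]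
    exact hs.le_tsum n fun m _ => by positivity
  · rintro ⟨C, R, hR, hf⟩
    refine ⟨R⁻¹ / 2, by positivity, .of_nonneg_of_le (fun n => by positivity) (fun n => ?_)
      (summable_geometric_two.mul_left C)⟩
    calc ‖coeff n f‖ * (R⁻¹ / 2) ^ n
        ≤ C * R ^ n * (R⁻¹ / 2) ^ n := by gcongr; exact hf n
      _ = C * (R * (R⁻¹ / 2)) ^ n := by rw [mul_assoc, mul_pow]
      _ = C * (1 / 2) ^ n := by rw [mul_div_assoc', mul_inv_cancel₀ hR.ne']

theorem inv_mem {f : ℂ⟦X⟧} (hf : f ∈ ConvergentSeries) : f⁻¹ ∈ ConvergentSeries := by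
  obtain ⟨C, R, hR, hf⟩ := mem_iff_norm_coeff_le.1 hf
  have hC : 0 ≤ C := (norm_nonneg _).trans (by simpa using hf 0)
  exact mem_iff_norm_coeff_le.2 ⟨_, _, by positivity, norm_coeff_inv_le hR.le hf⟩

theorem divXPowOrder_mem {f : ℂ⟦X⟧} (hf : f ∈ ConvergentSeries) :
    divXPowOrder f ∈ ConvergentSeries := by
  obtain ⟨C, R, hR, hf⟩ := mem_iff_norm_coeff_le.1 hf
  refine mem_iff_norm_coeff_le.2 ⟨C * R ^ f.order.toNat, R, hR, fun n => ?_⟩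
  rw [coeff_divXPowOrder, mul_assoc, ← pow_add, add_comm]
  exact hf _

/-- The variable `z₁` of `ℂ{z₁}`. -/
noncomputable def z : ConvergentSeries :=
  ⟨X, 1, one_pos, summable_of_ne_finset_zero (s := {1}) fun n hn => by
    simp [coeff_X, Finset.mem_singleton.not.1 hn]⟩

theorem coe_z : (z : ℂ⟦X⟧) = X := rfl

theorem isUnit_iff {f : ConvergentSeries} : IsUnit f ↔ constantCoeff (f : ℂ⟦X⟧) ≠ 0 :=
  ⟨fun hf => (hf.map ((constantCoeff (R := ℂ)).comp ConvergentSeries.subtype)).ne_zero,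
    fun hf => .of_mul_eq_one ⟨_, inv_mem f.2⟩ (Subtype.ext (PowerSeries.mul_inv_cancel _ hf))⟩

theorem exists_eq_z_pow_mul_unit {f : ConvergentSeries} (hf : f ≠ 0) :
    ∃ u : ConvergentSeriesˣ, f = z ^ (order (f : ℂ⟦X⟧)).toNat * u := by
  have hu : IsUnit (⟨_, divXPowOrder_mem f.2⟩ : ConvergentSeries) :=
    isUnit_iff.2 <| by simpa [constantCoeff_divXPowOrder_eq_zero_iff] using hf
  exact ⟨hu.unit, Subtype.ext (X_pow_order_mul_divXPowOrder (f := (f : ℂ⟦X⟧))).symm⟩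

theorem irreducible_z : Irreducible z := by
  refine ⟨isUnit_iff.not.2 (by simp [z]), fun a b hab => ?_⟩
  have hX : (X : ℂ⟦X⟧) = a * b := congrArg Subtype.val hab
  refine (X_irreducible.isUnit_or_isUnit hX).imp ?_ ?_ <;>
    exact fun h => isUnit_iff.2 (PowerSeries.isUnit_iff_constantCoeff.1 h).ne_zero

instance : IsDiscreteValuationRing ConvergentSeries :=
  .ofHasUnitMulPowIrreducibleFactorization
    ⟨z, irreducible_z, fun hf => ⟨_, (exists_eq_z_pow_mul_unit hf).imp fun _ => Eq.symm⟩⟩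

theorem addVal_eq_order (f : ConvergentSeries) :
    IsDiscreteValuationRing.addVal ConvergentSeries f = order (f : ℂ⟦X⟧) := by
  rcases eq_or_ne f 0 with rfl | hf
  · simp
  obtain ⟨u, hu⟩ := exists_eq_z_pow_mul_unit hf
  rw [IsDiscreteValuationRing.addVal_def f u irreducible_z _ (hu.trans (mul_comm _ _)),
    ENat.natCast_toNat (order_eq_top.not.2 (by simpa using hf))]

instance : CharZero ConvergentSeries :=
  ((constantCoeff (R := ℂ)).comp ConvergentSeries.subtype).charZero

instance : CharZero ConvergentSeriesField :=
  charZero_of_injective_algebraMap (IsFractionRing.injective ConvergentSeries _)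

end ConvergentSeries

section ValuationExtension

open WithZero IsDedekindDomain

/-- `a ↦ - log a / e`, with value `⊤` at `0`: turns multiplicative into additive values, rescaled so
that elements of logarithm `-e` get value `1`. -/
def negLogDiv (e : ℚ) (a : ℤᵐ⁰) : WithTop ℚ :=
  if a = 0 then ⊤ else ((-log a / e : ℚ) : WithTop ℚ)

theorem negLogDiv_zero (e : ℚ) : negLogDiv e 0 = ⊤ := if_pos rfl

theorem negLogDiv_of_ne_zero (e : ℚ) {a : ℤᵐ⁰} (ha : a ≠ 0) :
    negLogDiv e a = ((-log a / e : ℚ) : WithTop ℚ) := if_neg ha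

theorem negLogDiv_mul (e : ℚ) (a b : ℤᵐ⁰) :
    negLogDiv e (a * b) = negLogDiv e a + negLogDiv e b := by
  rcases eq_or_ne a 0 with rfl | ha
  · simp [negLogDiv_zero]
  rcases eq_or_ne b 0 with rfl | hb
  · simp [negLogDiv_zero]
  rw [negLogDiv_of_ne_zero e ha, negLogDiv_of_ne_zero e hb,
    negLogDiv_of_ne_zero e (mul_ne_zero ha hb), log_mul ha hb, ← WithTop.coe_add, Int.cast_add,
    neg_add, add_div]

theorem negLogDiv_antitone {e : ℚ} (he : 0 ≤ e) : Antitone (negLogDiv e) := by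
  intro a b hab
  rcases eq_or_ne a 0 with rfl | ha
  · simp [negLogDiv_zero]
  have hb : b ≠ 0 := ((zero_lt_iff.2 ha).trans_le hab).ne'
  rw [negLogDiv_of_ne_zero e ha, negLogDiv_of_ne_zero e hb, WithTop.coe_le_coe]
  gcongr
  exact (log_le_log ha hb).2 hab

/-- The additive rational form of a `ℤᵐ⁰`-valued valuation, rescaled by `e⁻¹`. -/
def ratAddValuation {R : Type*} [Ring R] (v : Valuation R ℤᵐ⁰) {e : ℚ} (he : 0 ≤ e) :
    AddValuation R (WithTop ℚ) :=
  .of (fun x => negLogDiv e (v x)) (by rw [map_zero, negLogDiv_zero])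
    (by simp [negLogDiv])
    (fun x y => by
      rw [← (negLogDiv_antitone he).map_max]
      exact negLogDiv_antitone he (v.map_add x y))
    (fun x y => by rw [map_mul, negLogDiv_mul])

theorem ratAddValuation_apply {R : Type*} [Ring R] (v : Valuation R ℤᵐ⁰) {e : ℚ} (he : 0 ≤ e)
    (x : R) : ratAddValuation v he x = negLogDiv e (v x) := rfl

variable (A K L : Type*) [CommRing A] [IsDomain A] [IsDiscreteValuationRing A] [Field K]
  [Algebra A K] [IsFractionRing A K] [Field L] [Algebra K L] [Algebra A L] [IsScalarTower A K L]
  [FiniteDimensional K L] [Algebra.IsSeparable K L]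

include K in
theorem exists_valuation_dominating :
    ∃ v : Valuation L ℤᵐ⁰, ∀ a : A,
      v (algebraMap A L a) ≤ 1 ∧ (v (algebraMap A L a) < 1 ↔ ¬ IsUnit a) := by
  let B := integralClosure A L
  have : IsDedekindDomain B := integralClosure.isDedekindDomain A K L
  have : IsFractionRing B L := integralClosure.isFractionRing_of_finite_extension K L
  have : FaithfulSMul A L := FaithfulSMul.trans A K L
  have : FaithfulSMul A B := FaithfulSMul.tower_bot A B L
  obtain ⟨P, hP, hPA⟩ :=
    Ideal.exists_maximal_ideal_liesOver_of_isIntegral (IsLocalRing.maximalIdeal A) (S := B)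
  have hP0 : P ≠ ⊥ :=
    Ideal.ne_bot_of_liesOver_of_ne_bot (IsDiscreteValuationRing.not_a_field A) P
  let 𝔓 : HeightOneSpectrum B := ⟨P, hP.isPrime, hP0⟩
  refine ⟨𝔓.valuation L, fun a => ?_⟩
  rw [IsScalarTower.algebraMap_apply A B L, 𝔓.valuation_lt_one_iff_mem]
  exact ⟨𝔓.valuation_le_one _, (P.mem_of_liesOver (IsLocalRing.maximalIdeal A) a).symm⟩

include K in
theorem exists_addValuation_extending_addVal :
    ∃ w : AddValuation L (WithTop ℚ), ∀ a : A,
      w (algebraMap A L a) = (IsDiscreteValuationRing.addVal A a).map (Nat.cast : ℕ → ℚ) := by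
  obtain ⟨v, hv⟩ := exists_valuation_dominating A K L
  obtain ⟨ϖ, hϖ⟩ := IsDiscreteValuationRing.exists_irreducible A
  have hinj : Function.Injective (algebraMap A L) := by
    rw [IsScalarTower.algebraMap_eq A K L]
    exact (algebraMap K L).injective.comp (IsFractionRing.injective A K)
  have hϖ0 : v (algebraMap A L ϖ) ≠ 0 :=
    (map_ne_zero v).2 ((map_ne_zero_iff _ hinj).2 hϖ.ne_zero)
  have hlog : (0 : ℚ) < -log (v (algebraMap A L ϖ)) := by
    have := (log_lt_log hϖ0 one_ne_zero).2 ((hv ϖ).2.2 hϖ.not_isUnit)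
    exact neg_pos.2 (by exact_mod_cast log_one (M := ℤ) ▸ this)
  refine ⟨ratAddValuation v hlog.le, fun a => ?_⟩
  rcases eq_or_ne a 0 with rfl | ha
  · simp
  obtain ⟨n, u, rfl⟩ := IsDiscreteValuationRing.eq_unit_mul_pow_irreducible ha hϖ
  have hu : v (algebraMap A L u) = 1 :=
    (hv u).1.eq_of_not_lt fun h => (hv u).2.1 h u.isUnit
  rw [IsDiscreteValuationRing.addVal_def' u hϖ, ratAddValuation_apply, map_mul, map_mul, hu,
    one_mul, map_pow, map_pow, negLogDiv_of_ne_zero _ (pow_ne_zero n hϖ0), log_pow, nsmul_eq_mul,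
    Int.cast_mul, ← mul_neg, mul_div_assoc, div_self hlog.ne', mul_one]
  rfl

end ValuationExtension

theorem exists_splitting_extension (f : Polynomial ConvergentSeries) :
    ∃ (L : Type) (_ : Field L) (_ : Algebra ConvergentSeriesField L)
      (_ : FiniteDimensional ConvergentSeriesField L) (_ : IsGalois ConvergentSeriesField L)
      (w : AddValuation L (WithTop ℚ)), ExtendsAdic w ∧ (overField L f).Splits := by
  let p : Polynomial ConvergentSeriesField := f.map (algebraMap _ _)
  have : Normal ConvergentSeriesField p.SplittingField := .of_isSplittingField p
  obtain ⟨w, hw⟩ := exists_addValuation_extending_addVal ConvergentSeries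
    ConvergentSeriesField p.SplittingField
  refine ⟨p.SplittingField, inferInstance, inferInstance, inferInstance, ⟨⟩, w, fun a => ?_, ?_⟩
  · rw [← IsScalarTower.algebraMap_apply, hw, ConvergentSeries.addVal_eq_order]
    rfl
  · simpa only [overField, ← Polynomial.map_map] using Polynomial.SplittingField.splits p

section GaussValuation

open Polynomial Finset.HasAntidiagonal

variable {R Γ : Type*} [CommRing R] [LinearOrderedAddCommMonoidWithTop Γ]

/-- The value `min_j (w (f_j) + j ρ)` of the Gauss valuation of weight `ρ`; see `gaussValuation`. -/
def gaussValue (w : AddValuation R Γ) (ρ : Γ) (f : R[X]) : Γ :=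
  f.support.inf fun j => w (f.coeff j) + j • ρ

variable (w : AddValuation R Γ) (ρ : Γ)

theorem le_gaussValue_iff {c : Γ} {f : R[X]} :
    c ≤ gaussValue w ρ f ↔ ∀ j, c ≤ w (f.coeff j) + j • ρ := by
  rw [gaussValue, Finset.le_inf_iff]
  refine ⟨fun h j => ?_, fun h j _ => h j⟩
  by_cases hj : j ∈ f.support
  · exact h j hj
  · simp [notMem_support_iff.1 hj]

theorem gaussValue_le (f : R[X]) (j : ℕ) : gaussValue w ρ f ≤ w (f.coeff j) + j • ρ :=
  (le_gaussValue_iff w ρ).1 le_rfl j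

theorem exists_gaussValue_eq {f : R[X]} (hf : gaussValue w ρ f ≠ ⊤) :
    ∃ j, gaussValue w ρ f = w (f.coeff j) + j • ρ := by
  have hne : f.support.Nonempty :=
    Finset.nonempty_iff_ne_empty.2 fun h => hf (by simp [gaussValue, h])
  obtain ⟨j, -, hj⟩ := Finset.exists_mem_eq_inf _ hne fun j => w (f.coeff j) + j • ρ
  exact ⟨j, hj⟩

theorem gaussValue_C (a : R) : gaussValue w ρ (C a) = w a := by
  refine eq_of_forall_le_iff fun c =>
    (le_gaussValue_iff w ρ).trans ⟨fun h => by simpa using h 0, ?_⟩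
  rintro h (_ | j) <;> simp [coeff_C, h]

theorem min_gaussValue_le_add (f g : R[X]) :
    min (gaussValue w ρ f) (gaussValue w ρ g) ≤ gaussValue w ρ (f + g) := by
  refine (le_gaussValue_iff w ρ).2 fun j => ?_
  rw [coeff_add]
  refine (min_le_min (gaussValue_le w ρ f j) (gaussValue_le w ρ g j)).trans ?_
  rw [min_add_add_right]
  gcongr
  exact w.map_add _ _

theorem addValuation_mul_add_nsmul (a b : R) (i j : ℕ) :
    w (a * b) + (i + j) • ρ = (w a + i • ρ) + (w b + j • ρ) := by
  rw [w.map_mul, add_nsmul, add_add_add_comm]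

theorem add_gaussValue_le_mul (f g : R[X]) :
    gaussValue w ρ f + gaussValue w ρ g ≤ gaussValue w ρ (f * g) := by
  refine (le_gaussValue_iff w ρ).2 fun n => ?_
  obtain ⟨⟨i, j⟩, hij, hmin⟩ := (antidiagonal n).exists_min_image
    (fun x => w (f.coeff x.1 * g.coeff x.2)) ⟨(0, n), by simp⟩
  calc gaussValue w ρ f + gaussValue w ρ g
      ≤ (w (f.coeff i) + i • ρ) + (w (g.coeff j) + j • ρ) :=
        add_le_add (gaussValue_le w ρ f i) (gaussValue_le w ρ g j)
    _ = w (f.coeff i * g.coeff j) + n • ρ := by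
        rw [← addValuation_mul_add_nsmul, mem_antidiagonal.1 hij]
    _ ≤ w ((f * g).coeff n) + n • ρ := by
        gcongr
        rw [coeff_mul]
        exact w.map_le_sum hmin

theorem exists_first_gaussValue_eq {f : R[X]} (hf : gaussValue w ρ f ≠ ⊤) :
    ∃ i, gaussValue w ρ f = w (f.coeff i) + i • ρ ∧
      ∀ j < i, gaussValue w ρ f < w (f.coeff j) + j • ρ := by
  classical
  have h := exists_gaussValue_eq w ρ hf
  exact ⟨Nat.find h, Nat.find_spec h, fun j hj =>
    (gaussValue_le w ρ f j).lt_of_ne (Nat.find_min h hj)⟩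

/-- At the sum of the first indices where the two minima are attained, a single term of the
coefficient of the product has the least value, so nothing cancels. -/
theorem gaussValue_mul_le {f g : R[X]} (hf : gaussValue w ρ f ≠ ⊤) (hg : gaussValue w ρ g ≠ ⊤) :
    gaussValue w ρ (f * g) ≤ gaussValue w ρ f + gaussValue w ρ g := by
  obtain ⟨i, hi, hi'⟩ := exists_first_gaussValue_eq w ρ hf
  obtain ⟨j, hj, hj'⟩ := exists_first_gaussValue_eq w ρ hg
  have hsum : gaussValue w ρ f + gaussValue w ρ g = w (f.coeff i * g.coeff j) + (i + j) • ρ := by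
    rw [addValuation_mul_add_nsmul, ← hi, ← hj]
  have hterm : ∀ x ∈ (antidiagonal (i + j)).erase (i, j),
      w (f.coeff i * g.coeff j) < w (f.coeff x.1 * g.coeff x.2) := by
    rintro ⟨k, l⟩ hkl
    obtain ⟨hne, hkl⟩ := Finset.mem_erase.1 hkl
    have hkl : k + l = i + j := mem_antidiagonal.1 hkl
    refine lt_of_add_lt_add_right (a := (i + j) • ρ) ?_
    rw [← hsum, ← hkl, addValuation_mul_add_nsmul]
    rcases lt_trichotomy k i with hk | rfl | hk
    · exact ((add_lt_add_iff_left_of_ne_top hg).2 (hi' k hk)).trans_le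
        (by gcongr; exact gaussValue_le w ρ g l)
    · exact absurd (by rw [Nat.add_left_cancel hkl]) hne
    · exact ((add_lt_add_iff_right_of_ne_top hf).2 (hj' l (by omega))).trans_le
        (by gcongr; exact gaussValue_le w ρ f k)
  have htop : w (f.coeff i * g.coeff j) ≠ ⊤ := fun h => by
    rw [h, top_add, ← add_top (gaussValue w ρ f), add_right_inj_of_ne_top hf] at hsum
    exact hg hsum
  have hcoeff : w ((f * g).coeff (i + j)) = w (f.coeff i * g.coeff j) := by
    rw [coeff_mul, ← Finset.add_sum_erase _ _ (mem_antidiagonal.2 rfl : (i, j) ∈ antidiagonal _)]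
    exact w.map_add_eq_of_lt_left (w.map_lt_sum htop hterm)
  rw [hsum, ← hcoeff]
  exact gaussValue_le w ρ (f * g) (i + j)

theorem gaussValue_mul (f g : R[X]) :
    gaussValue w ρ (f * g) = gaussValue w ρ f + gaussValue w ρ g := by
  refine le_antisymm ?_ (add_gaussValue_le_mul w ρ f g)
  by_cases hf : gaussValue w ρ f = ⊤
  · simp [hf]
  by_cases hg : gaussValue w ρ g = ⊤
  · simp [hg]
  exact gaussValue_mul_le w ρ hf hg

/-- The Gauss valuation: the extension of `w` to `R[X]` for which `X` has value `ρ` and the value of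
a polynomial is the least value of its monomials. -/
noncomputable def gaussValuation : AddValuation R[X] Γ :=
  .of (gaussValue w ρ) rfl (by rw [← C_1, gaussValue_C, w.map_one]) (min_gaussValue_le_add w ρ)
    (gaussValue_mul w ρ)

theorem le_gaussValuation_iff {c : Γ} {f : R[X]} :
    c ≤ gaussValuation w ρ f ↔ ∀ j, c ≤ w (f.coeff j) + j • ρ :=
  le_gaussValue_iff w ρ

theorem gaussValuation_X_sub_C (a : R) : gaussValuation w ρ (X - C a) = min ρ (w a) := by
  refine eq_of_forall_le_iff fun c => ?_
  rw [le_gaussValuation_iff, le_min_iff]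
  refine ⟨fun h => ⟨by simpa using h 1, by simpa using h 0⟩, ?_⟩
  rintro ⟨hρ, ha⟩ (_ | _ | j)
  · simpa using ha
  · simpa using hρ
  · simp [coeff_X]

theorem gaussValuation_map {S : Type*} [CommRing S] (φ : S →+* R) (f : S[X]) :
    gaussValuation w ρ (f.map φ) = gaussValuation (w.comap φ) ρ f :=
  eq_of_forall_le_iff fun c => by simp only [le_gaussValuation_iff, coeff_map]; rfl

theorem gaussValuation_multiset_prod_X_sub_C (s : Multiset R) :
    gaussValuation w ρ (s.map fun a => X - C a).prod = (s.map fun a => min ρ (w a)).sum := by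
  induction s using Multiset.induction_on with
  | empty => simp
  | cons a s ih => simp [AddValuation.map_mul, gaussValuation_X_sub_C, ih]

end GaussValuation

section NewtonRegion

theorem exists_finite_isAntichain_subset {α : Type*} [PartialOrder α] [WellQuasiOrderedLE α]
    (s : Set α) : ∃ t ⊆ s, t.Finite ∧ IsAntichain (· ≤ ·) t ∧ ∀ a ∈ s, ∃ b ∈ t, b ≤ a :=
  have hanti : IsAntichain (· ≤ ·) {a | Minimal (· ∈ s) a} := setOfPred_minimal_antichain _
  ⟨{a | Minimal (· ∈ s) a}, fun _ ha => ha.prop, WellQuasiOrderedLE.finite_of_isAntichain hanti,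
    hanti, fun a ha =>
      have ⟨b, hba, hb⟩ := exists_minimal_le_of_wellFoundedLT (· ∈ s) a ha
      ⟨b, hb, hba⟩⟩

theorem cast_add_mem_newtonRegion {S : Set (ℕ × ℕ)} {p d : ℝ × ℝ}
    (hp : p ∈ convexHull ℝ ((fun A : ℕ × ℕ => ((A.1 : ℝ), (A.2 : ℝ))) '' S)) (hd : 0 ≤ d) :
    p + d ∈ newtonRegion S := by
  have hray : ∀ x : ℝ, 0 ≤ x → x ∈ convexHull ℝ (Set.range (Nat.cast : ℕ → ℝ)) := fun x hx => by
    refine segment_subset_convexHull (x := (0 : ℝ)) (y := (⌈x⌉₊ : ℝ))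
      (Set.mem_range.2 ⟨0, by simp⟩) (Set.mem_range_self _) ?_
    rw [segment_eq_Icc (by positivity)]
    exact ⟨hx, Nat.le_ceil x⟩
  have hsum : p + d ∈ convexHull ℝ ((fun A : ℕ × ℕ => ((A.1 : ℝ), (A.2 : ℝ))) '' S +
      Set.range (Nat.cast : ℕ → ℝ) ×ˢ Set.range (Nat.cast : ℕ → ℝ)) := by
    rw [convexHull_add]
    exact Set.add_mem_add hp (mk_mem_convexHull_prod (hray d.1 hd.1) (hray d.2 hd.2))
  refine convexHull_mono ?_ hsum
  rintro _ ⟨_, ⟨A, hA, rfl⟩, ⟨x, y⟩, ⟨⟨m, rfl⟩, ⟨n, rfl⟩⟩, rfl⟩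
  exact ⟨A, hA, (m, n), by simp⟩

theorem cast_mem_newtonRegion {S : Set (ℕ × ℕ)} {A : ℕ × ℕ} (hA : A ∈ S) :
    ((A.1 : ℝ), (A.2 : ℝ)) ∈ newtonRegion S :=
  subset_convexHull ℝ _ ⟨A, hA, 0, by simp⟩

theorem exists_le_of_mem_newtonRegion {S : Set (ℕ × ℕ)} {ρ : ℝ} (hρ : 0 ≤ ρ) {p : ℝ × ℝ}
    (hp : p ∈ newtonRegion S) : ∃ A ∈ S, (A.1 + ρ * A.2 : ℝ) ≤ p.1 + ρ * p.2 := by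
  by_contra! hS
  have hconv : Convex ℝ {x : ℝ × ℝ | p.1 + ρ * p.2 < x.1 + ρ * x.2} :=
    convex_halfSpace_gt (f := fun x : ℝ × ℝ => x.1 + ρ * x.2)
      ⟨fun x y => by simp only [Prod.fst_add, Prod.snd_add]; ring,
        fun c x => by simp only [Prod.smul_fst, Prod.smul_snd, smul_eq_mul]; ring⟩ _
  refine lt_irrefl (p.1 + ρ * p.2) (convexHull_min ?_ hconv hp)
  rintro _ ⟨A, hA, B, rfl⟩
  refine (hS A hA).trans_le ?_
  dsimp only
  gcongr <;> simp

theorem nonpos_of_forall_le_lt {E : Type*} [AddCommGroup E] [PartialOrder E] [IsOrderedAddMonoid E]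
    (f : E →+ ℝ) {q d : E} {v : ℝ} (hf : ∀ p ≤ q, v < f p) (hd : 0 ≤ d) : f d ≤ 0 := by
  by_contra! hpos
  obtain ⟨n, hn⟩ := Archimedean.arch (f q - v) hpos
  have hlt := hf (q - n • d) (sub_le_self q (nsmul_nonneg hd n))
  rw [map_sub, map_nsmul] at hlt
  linarith

theorem exists_line_separating {S : Set (ℕ × ℕ)} {q : ℝ × ℝ} (hqS : q ∉ newtonRegion S) :
    ∃ a b c : ℝ, 0 ≤ a ∧ 0 ≤ b ∧ a * q.1 + b * q.2 < c ∧ ∀ A ∈ S, c < a * A.1 + b * A.2 := by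
  obtain ⟨T, hTS, hT, -, hdom⟩ := exists_finite_isAntichain_subset S
  have hdisj : Disjoint (convexHull ℝ ((fun A : ℕ × ℕ => ((A.1 : ℝ), (A.2 : ℝ))) '' T))
      (Set.Iic q) := Set.disjoint_left.2 fun p hp hpq => hqS <| by
    simpa using cast_add_mem_newtonRegion (convexHull_mono (Set.image_mono hTS) hp)
      (sub_nonneg.2 (Set.mem_Iic.1 hpq))
  obtain ⟨f, u, v, hfT, huv, hfq⟩ := geometric_hahn_banach_compact_closed
    (convex_convexHull ℝ _) ((hT.image _).isCompact_convexHull (𝕜 := ℝ)) (convex_Iic q)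
    isClosed_Iic hdisj
  have hf : ∀ p : ℝ × ℝ, f p = f (1, 0) * p.1 + f (0, 1) * p.2 := fun p => by
    rw [mul_comm, mul_comm (f (0, 1)), ← smul_eq_mul, ← smul_eq_mul, ← map_smul, ← map_smul,
      ← map_add]
    simp
  have hneg : ∀ d : ℝ × ℝ, 0 ≤ d → f d ≤ 0 := fun d =>
    nonpos_of_forall_le_lt (f : ℝ × ℝ →+ ℝ) hfq
  have ha : f (1, 0) ≤ 0 := hneg _ (by simp [Prod.le_def])
  have hb : f (0, 1) ≤ 0 := hneg _ (by simp [Prod.le_def])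
  refine ⟨-f (1, 0), -f (0, 1), -u, neg_nonneg.2 ha, neg_nonneg.2 hb, ?_, fun A hA => ?_⟩
  · have := hfq q Set.self_mem_Iic
    rw [hf] at this
    linarith
  · obtain ⟨B, hB, hBA⟩ := hdom A hA
    have hBu := hfT _ (subset_convexHull ℝ _ (Set.mem_image_of_mem _ hB))
    rw [hf] at hBu
    have hfst : (B.1 : ℝ) ≤ A.1 := by exact_mod_cast hBA.1
    have hsnd : (B.2 : ℝ) ≤ A.2 := by exact_mod_cast hBA.2
    nlinarith

theorem exists_rat_slope_separating {S : Set (ℕ × ℕ)} {q : ℝ × ℝ} (hq : 0 ≤ q)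
    (hqS : q ∉ newtonRegion S) :
    ∃ ρ : ℚ, 0 < ρ ∧ ∀ A ∈ S, q.1 + ρ * q.2 < (A.1 + ρ * A.2 : ℝ) := by
  obtain ⟨a, b, c, ha, hb, hqc, hS⟩ := exists_line_separating hqS
  obtain ⟨ε, hε, hεc⟩ := exists_pos_mul_lt (sub_pos.2 hqc) (q.1 + q.2)
  obtain ⟨a', haa', ha'⟩ := exists_rat_btwn (lt_add_of_pos_right a hε)
  obtain ⟨b', hbb', hb'⟩ := exists_rat_btwn (lt_add_of_pos_right b hε)
  have ha'0 : (0 : ℝ) < a' := ha.trans_lt haa'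
  have hb'0 : (0 : ℝ) < b' := hb.trans_lt hbb'
  refine ⟨b' / a', div_pos (by exact_mod_cast hb'0) (by exact_mod_cast ha'0), fun A hA => ?_⟩
  have hlt : a' * q.1 + b' * q.2 < a' * A.1 + b' * A.2 :=
    calc a' * q.1 + b' * q.2 ≤ (a + ε) * q.1 + (b + ε) * q.2 := by
          gcongr
          exacts [hq.1, hq.2]
      _ = a * q.1 + b * q.2 + (q.1 + q.2) * ε := by ring
      _ < a * A.1 + b * A.2 := (lt_sub_iff_add_lt'.1 hεc).trans (hS A hA)
      _ ≤ a' * A.1 + b' * A.2 := by gcongr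
  have hdiv : ∀ x y : ℝ, x + (b' / a' : ℚ) * y = (a' * x + b' * y) / a' := fun x y => by
    push_cast
    field_simp
  rw [hdiv, hdiv]
  gcongr

/-- The value at `(i, j)` of the linear form whose level lines have slope `-1 / ρ`. -/
def lineWeight (ρ : ℚ) (A : ℕ × ℕ) : ℚ := A.1 + ρ * A.2

theorem lineWeight_le_iff {ρ : ℚ} {A B : ℕ × ℕ} :
    lineWeight ρ A ≤ lineWeight ρ B ↔ (A.1 + ρ * A.2 : ℝ) ≤ B.1 + ρ * B.2 := by
  unfold lineWeight
  norm_cast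

theorem lineWeight_mono {ρ : ℚ} (hρ : 0 ≤ ρ) : Monotone (lineWeight ρ) := fun A B hAB => by
  unfold lineWeight
  gcongr
  exacts [hAB.1, hAB.2]

theorem lineWeight_add (ρ : ℚ) (A B : ℕ × ℕ) :
    lineWeight ρ (A + B) = lineWeight ρ A + lineWeight ρ B := by
  simp only [lineWeight, Prod.fst_add, Prod.snd_add, Nat.cast_add]
  ring

theorem newtonRegion_subset_iff {S T : Set (ℕ × ℕ)} :
    newtonRegion S ⊆ newtonRegion T ↔
      ∀ ρ : ℚ, 0 < ρ → ∀ A ∈ S, ∃ B ∈ T, lineWeight ρ B ≤ lineWeight ρ A := by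
  constructor
  · intro h ρ hρ A hA
    obtain ⟨B, hB, hBA⟩ := exists_le_of_mem_newtonRegion (ρ := ρ) (by exact_mod_cast hρ.le)
      (h (cast_mem_newtonRegion hA))
    exact ⟨B, hB, lineWeight_le_iff.2 hBA⟩
  · refine fun h => convexHull_min ?_ (convex_convexHull ℝ _)
    rintro _ ⟨A, hA, D, rfl⟩
    by_contra hmem
    obtain ⟨ρ, hρ, hlt⟩ := exists_rat_slope_separating ⟨by positivity, by positivity⟩ hmem
    obtain ⟨B, hB, hBA⟩ := h ρ hρ A hA
    refine (hlt B hB).not_ge ((lineWeight_le_iff.1 hBA).trans ?_)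
    dsimp only
    gcongr <;> simp

theorem newtonRegion_eq_iff {S T : Set (ℕ × ℕ)} :
    newtonRegion S = newtonRegion T ↔
      ∀ ρ : ℚ, 0 < ρ → ∀ c, (∃ A ∈ S, lineWeight ρ A ≤ c) ↔ ∃ B ∈ T, lineWeight ρ B ≤ c := by
  rw [Set.Subset.antisymm_iff, newtonRegion_subset_iff, newtonRegion_subset_iff]
  refine ⟨fun ⟨hST, hTS⟩ ρ hρ c => ⟨?_, ?_⟩, fun h =>
    ⟨fun ρ hρ A hA => (h ρ hρ _).1 ⟨A, hA, le_rfl⟩, fun ρ hρ B hB => (h ρ hρ _).2 ⟨B, hB, le_rfl⟩⟩⟩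
  · rintro ⟨A, hA, hAc⟩
    exact (hST ρ hρ A hA).imp fun B hB => ⟨hB.1, hB.2.trans hAc⟩
  · rintro ⟨B, hB, hBc⟩
    exact (hTS ρ hρ B hB).imp fun A hA => ⟨hA.1, hA.2.trans hBc⟩

theorem exists_finset_isAntichain_newtonRegion_eq (S : Set (ℕ × ℕ)) :
    ∃ T : Finset (ℕ × ℕ), IsAntichain (· ≤ ·) (T : Set (ℕ × ℕ)) ∧
      newtonRegion T = newtonRegion S := by
  obtain ⟨T, hTS, hT, hanti, hdom⟩ := exists_finite_isAntichain_subset S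
  lift T to Finset (ℕ × ℕ) using hT
  refine ⟨T, hanti, (newtonRegion_subset_iff.2 fun ρ _ A hA => ⟨A, hTS hA, le_rfl⟩).antisymm
    (newtonRegion_subset_iff.2 fun ρ hρ A hA => ?_)⟩
  obtain ⟨B, hB, hBA⟩ := hdom A hA
  exact ⟨B, hB, lineWeight_mono hρ.le hBA⟩

theorem exists_zero_fst_mem_of_mem_newtonRegion {S : Set (ℕ × ℕ)} {y : ℝ}
    (h : (0, y) ∈ newtonRegion S) : ∃ n : ℕ, (0, n) ∈ S ∧ (n : ℝ) ≤ y := by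
  have hρ : 0 < (|y| + 1)⁻¹ := by positivity
  obtain ⟨⟨i, n⟩, hS, hle⟩ := exists_le_of_mem_newtonRegion hρ.le h
  have hy : (|y| + 1)⁻¹ * y < 1 := by
    rw [inv_mul_lt_iff₀ (by positivity)]
    linarith [le_abs_self y]
  have hi : (i : ℝ) < 1 := by
    have : 0 ≤ (|y| + 1)⁻¹ * n := by positivity
    simp only [zero_add] at hle
    linarith
  obtain rfl : i = 0 := by simpa using hi
  exact ⟨n, hS, by simpa [hρ] using hle⟩

theorem exists_zero_snd_mem_of_mem_newtonRegion {S : Set (ℕ × ℕ)} {x : ℝ}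
    (h : (x, 0) ∈ newtonRegion S) : ∃ m : ℕ, (m, 0) ∈ S := by
  obtain ⟨⟨m, j⟩, hS, hle⟩ :=
    exists_le_of_mem_newtonRegion (ρ := |x| + 1) (by positivity) h
  have hj : (j : ℝ) < 1 := by
    have : (0 : ℝ) ≤ m := by positivity
    simp only [mul_zero, add_zero] at hle
    nlinarith [le_abs_self x, abs_nonneg x]
  obtain rfl : j = 0 := by simpa using hj
  exact ⟨m, hS⟩

end NewtonRegion

section NewtonSupport

open Polynomial

/-- The `z₁`-adic valuation of `ℂ{z₁}`, with values in `ℚ ∪ {∞}`. -/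
noncomputable def ConvergentSeries.orderVal : AddValuation ConvergentSeries (WithTop ℚ) :=
  (IsDiscreteValuationRing.addVal ConvergentSeries).map
    (AddMonoidHom.withTopMap (Nat.castAddMonoidHom ℚ)) rfl
    (WithTop.monotone_map_iff.2 Nat.mono_cast)

theorem ConvergentSeries.orderVal_eq (a : ConvergentSeries) :
    orderVal a = WithTop.map (Nat.cast : ℕ → ℚ) (PowerSeries.order (a : ℂ⟦X⟧)) :=
  congrArg (WithTop.map (Nat.cast : ℕ → ℚ)) (addVal_eq_order a)

/-- The set of the `(i, j)` such that `z₁ ^ i * z₂ ^ j` has a nonzero coefficient in `f`. -/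
def newtonSupport (f : ConvergentSeries[X]) : Set (ℕ × ℕ) :=
  {A | PowerSeries.coeff A.1 (f.coeff A.2 : ℂ⟦X⟧) ≠ 0}

open ConvergentSeries

theorem mem_newtonSupport {f : ConvergentSeries[X]} {i j : ℕ} :
    (i, j) ∈ newtonSupport f ↔ PowerSeries.coeff i (f.coeff j : ℂ⟦X⟧) ≠ 0 := Iff.rfl

theorem region_newtonPolygon (f : ConvergentSeries[X]) :
    (newtonPolygon f).region = newtonRegion (newtonSupport f) := rfl

theorem gaussValuation_orderVal_le_iff {ρ c : ℚ} {f : ConvergentSeries[X]} :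
    gaussValuation orderVal (ρ : WithTop ℚ) f ≤ c ↔
      ∃ A ∈ newtonSupport f, lineWeight ρ A ≤ c := by
  have hcast (i j : ℕ) :
      (lineWeight ρ (i, j) : WithTop ℚ) =
        WithTop.map Nat.cast (i : ℕ∞) + j • (ρ : WithTop ℚ) := by
    rw [← WithTop.coe_nsmul, nsmul_eq_mul, mul_comm]
    rfl
  constructor
  · intro h
    obtain ⟨j, hj⟩ := exists_gaussValue_eq _ _ (ne_top_of_le_ne_top WithTop.coe_ne_top h)
    replace h := hj.symm.trans_le h
    rcases eq_or_ne (f.coeff j) 0 with hfj | hfj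
    · simp [hfj] at h
    · obtain ⟨i, hi⟩ := ENat.ne_top_iff_exists.1
        (PowerSeries.order_eq_top.not.2 (Subtype.coe_injective.ne hfj))
      refine ⟨(i, j), (PowerSeries.order_eq_nat.1 hi.symm).1, ?_⟩
      rw [orderVal_eq, ← hi] at h
      exact WithTop.coe_le_coe.1 ((hcast i j).trans_le h)
  · rintro ⟨⟨i, j⟩, hA, hAc⟩
    calc gaussValuation orderVal (ρ : WithTop ℚ) f
        ≤ orderVal (f.coeff j) + j • (ρ : WithTop ℚ) := gaussValue_le _ _ f j
      _ ≤ WithTop.map Nat.cast (i : ℕ∞) + j • (ρ : WithTop ℚ) := by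
        rw [orderVal_eq]
        gcongr
        exact WithTop.monotone_map_iff.2 Nat.mono_cast (PowerSeries.order_le i hA)
      _ ≤ c := (hcast i j).symm.trans_le (WithTop.coe_le_coe.2 hAc)

theorem newtonPolygon_eq_iff_gaussValuation {f g : ConvergentSeries[X]} :
    newtonPolygon f = newtonPolygon g ↔ ∀ ρ : ℚ, 0 < ρ →
      gaussValuation orderVal (ρ : WithTop ℚ) f = gaussValuation orderVal (ρ : WithTop ℚ) g := by
  rw [NewtonPolygon.ext_iff, region_newtonPolygon, region_newtonPolygon, newtonRegion_eq_iff]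
  simp only [← gaussValuation_orderVal_le_iff]
  exact forall₂_congr fun ρ _ => ⟨WithTop.eq_of_forall_le_coe_iff, fun h c => by rw [h]⟩

theorem newtonPolygon_mul (f g : ConvergentSeries[X]) :
    newtonPolygon (f * g) = newtonPolygon f + newtonPolygon g := by
  ext1
  rw [NewtonPolygon.region_add, region_newtonPolygon, region_newtonPolygon, region_newtonPolygon,
    newtonRegion_add, newtonRegion_eq_iff]
  refine fun ρ _ c => ?_
  rw [← gaussValuation_orderVal_le_iff, AddValuation.map_mul]
  constructor
  · intro h
    obtain ⟨hf, hg⟩ := WithTop.add_ne_top.1 (ne_top_of_le_ne_top WithTop.coe_ne_top h)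
    lift gaussValuation orderVal (ρ : WithTop ℚ) f to ℚ using hf with a ha
    lift gaussValuation orderVal (ρ : WithTop ℚ) g to ℚ using hg with b hb
    obtain ⟨A, hA, hAa⟩ := gaussValuation_orderVal_le_iff.1 ha.ge
    obtain ⟨B, hB, hBb⟩ := gaussValuation_orderVal_le_iff.1 hb.ge
    refine ⟨A + B, Set.add_mem_add hA hB, ?_⟩
    rw [lineWeight_add]
    exact (add_le_add hAa hBb).trans (by exact_mod_cast h)
  · rintro ⟨_, ⟨A, hA, B, hB, rfl⟩, hAB⟩
    rw [lineWeight_add] at hAB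
    exact (add_le_add (gaussValuation_orderVal_le_iff.2 ⟨A, hA, le_rfl⟩)
      (gaussValuation_orderVal_le_iff.2 ⟨B, hB, le_rfl⟩)).trans (by exact_mod_cast hAB)

theorem newtonPolygon_one : newtonPolygon 1 = 0 := by
  ext1
  rw [region_newtonPolygon, NewtonPolygon.region_zero]
  congr 1
  ext ⟨i, j⟩
  rcases j with _ | j <;> simp [mem_newtonSupport, PowerSeries.coeff_one, Polynomial.coeff_one]

theorem coeff_zero_ne_zero_of_mem_monicU {f : ConvergentSeries[X]} (hf : f ∈ monicU) :
    f.coeff 0 ≠ 0 :=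
  fun h => hf.2 (X_dvd_iff.2 h)

theorem newtonPolygon_mem_NU {f : ConvergentSeries[X]} (hf : f ∈ monicU) :
    newtonPolygon f ∈ NewtonPolygon.NU := by
  obtain ⟨m, hm⟩ := PowerSeries.exists_coeff_ne_zero_iff_ne_zero.2
    (Subtype.coe_injective.ne (coeff_zero_ne_zero_of_mem_monicU hf))
  have hn : (0, f.natDegree) ∈ newtonSupport f := by
    simp [mem_newtonSupport, hf.1.coeff_natDegree]
  refine ⟨⟨m, ?_⟩, f.natDegree, ?_⟩ <;> rw [region_newtonPolygon]
  · simpa using cast_mem_newtonRegion (mem_newtonSupport.2 hm)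
  · simpa using cast_mem_newtonRegion hn

/-- The homomorphism `f ↦ N(f)` from `U` to `NU`. -/
noncomputable def newtonHom : monicU →* Multiplicative NewtonPolygon.NU where
  toFun f := .ofAdd ⟨newtonPolygon f, newtonPolygon_mem_NU f.2⟩
  map_one' := congrArg Multiplicative.ofAdd (Subtype.ext newtonPolygon_one)
  map_mul' f g := congrArg Multiplicative.ofAdd (Subtype.ext (newtonPolygon_mul f.1 g.1))

theorem newtonHom_eq_iff {f g : monicU} :
    newtonHom f = newtonHom g ↔
      newtonPolygon (f : ConvergentSeries[X]) = newtonPolygon (g : ConvergentSeries[X]) :=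
  Multiplicative.toAdd.injective.eq_iff.symm.trans Subtype.ext_iff

/-- The degree in `z₂`, as a homomorphism on `U`. -/
noncomputable def degreeHom : monicU →* Multiplicative ℕ where
  toFun f := .ofAdd (f : ConvergentSeries[X]).natDegree
  map_one' := congrArg Multiplicative.ofAdd natDegree_one
  map_mul' f g := congrArg Multiplicative.ofAdd (f.2.1.natDegree_mul g.2.1)

end NewtonSupport

section TruncatedSums

section Zero

variable {α : Type*} [LinearOrder α] [Zero α] {M N : Multiset α}

theorem filter_pos_eq_of_count_eq (h : ∀ ρ, 0 < ρ → M.count ρ = N.count ρ) :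
    M.filter (0 < ·) = N.filter (0 < ·) := by
  ext ρ
  by_cases hρ : 0 < ρ <;> simp [hρ, h]

theorem count_zero_add_card_filter_pos (hM : ∀ a ∈ M, 0 ≤ a) :
    M.count 0 + (M.filter (0 < ·)).card = M.card := by
  induction M using Multiset.induction_on with
  | empty => simp
  | cons b M ih =>
    rw [Multiset.forall_mem_cons] at hM
    rcases hM.1.eq_or_lt with rfl | hb
    · simp [← ih hM.2, add_right_comm]
    · simp [← ih hM.2, hb, hb.ne, add_assoc]

theorem eq_of_count_eq_of_card_eq (hM : ∀ a ∈ M, 0 ≤ a) (hN : ∀ a ∈ N, 0 ≤ a)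
    (h : ∀ ρ, 0 < ρ → M.count ρ = N.count ρ) (hcard : M.card = N.card) : M = N := by
  ext ρ
  rcases lt_trichotomy ρ 0 with hρ | rfl | hρ
  · rw [Multiset.count_eq_zero.2 fun hmem => (hM ρ hmem).not_gt hρ,
      Multiset.count_eq_zero.2 fun hmem => (hN ρ hmem).not_gt hρ]
  · rw [← count_zero_add_card_filter_pos hM, ← count_zero_add_card_filter_pos hN,
      filter_pos_eq_of_count_eq h] at hcard
    exact add_right_cancel hcard
  · exact h ρ hρ

end Zero

section AddCommMonoid

variable {α : Type*} [LinearOrder α] [AddCommMonoid α] {M : Multiset α}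

/-- The sum of the `min ρ a` over `a ∈ M`. As a function of `ρ` it is concave and piecewise linear,
and at each `ρ` its slope drops by the multiplicity of `ρ` in `M`. -/
def truncSum (M : Multiset α) (ρ : α) : α :=
  (M.map (min ρ)).sum

theorem truncSum_cons (a : α) (M : Multiset α) (ρ : α) :
    truncSum (a ::ₘ M) ρ = min ρ a + truncSum M ρ := by
  simp [truncSum]

theorem truncSum_map_coe (M : Multiset α) (ρ : α) :
    truncSum (M.map WithTop.some) (ρ : WithTop α) = truncSum M ρ := by
  induction M using Multiset.induction_on with
  | empty => simp [truncSum]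
  | cons a M ih => rw [Multiset.map_cons, truncSum_cons, truncSum_cons, ih]; norm_cast

theorem nonneg_of_truncSum_zero_nonneg [IsOrderedAddMonoid α] (h : 0 ≤ truncSum M 0) {a : α}
    (ha : a ∈ M) : 0 ≤ a := by
  obtain ⟨N, rfl⟩ := Multiset.exists_cons_of_mem ha
  have hN : truncSum N 0 ≤ 0 :=
    (Multiset.sum_le_card_nsmul (N.map (min 0)) 0 (by simp)).trans_eq (nsmul_zero _)
  contrapose! h
  rw [truncSum_cons, min_eq_right h.le]
  exact add_neg_of_neg_of_nonpos h hN

theorem truncSum_filter_pos (hM : ∀ a ∈ M, 0 ≤ a) {ρ : α} (hρ : 0 ≤ ρ) :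
    truncSum (M.filter (0 < ·)) ρ = truncSum M ρ := by
  induction M using Multiset.induction_on with
  | empty => simp
  | cons b M ih =>
    rw [Multiset.forall_mem_cons] at hM
    rcases hM.1.eq_or_lt with rfl | hb
    · simp [truncSum_cons, ih hM.2, hρ]
    · simp [truncSum_cons, ih hM.2, hb]

end AddCommMonoid

theorem exists_pos_le_forall_le_abs_sub {α : Type*} [AddCommGroup α] [LinearOrder α]
    [IsOrderedAddMonoid α] (M : Multiset α) (ρ : α) {δ : α} (hδ : 0 < δ) :
    ∃ ε, 0 < ε ∧ ε ≤ δ ∧ ∀ a ∈ M, a ≠ ρ → ε ≤ |a - ρ| := by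
  let s := insert δ ((M.toFinset.erase ρ).image fun a => |a - ρ|)
  have hs : s.Nonempty := Finset.insert_nonempty _ _
  refine ⟨s.min' hs, (s.lt_min'_iff hs).2 fun x hx => ?_, s.min'_le _ (Finset.mem_insert_self _ _),
    fun a ha hne => s.min'_le _ (Finset.mem_insert_of_mem (Finset.mem_image_of_mem _ ?_))⟩
  · rcases Finset.mem_insert.1 hx with rfl | hx
    · exact hδ
    · obtain ⟨a, ha, rfl⟩ := Finset.mem_image.1 hx
      exact abs_pos.2 (sub_ne_zero.2 (Finset.ne_of_mem_erase ha))
  · exact Finset.mem_erase.2 ⟨hne, Multiset.mem_toFinset.2 ha⟩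

variable {𝕜 : Type*} [Field 𝕜] [LinearOrder 𝕜] [IsStrictOrderedRing 𝕜] {M N : Multiset 𝕜}

theorem min_add_add_min_sub_add_ite {ρ ε a : 𝕜} (hε : 0 ≤ ε) (h : a ≠ ρ → ε ≤ |a - ρ|) :
    min (ρ + ε) a + min (ρ - ε) a + (if ρ = a then ε else 0) = 2 * min ρ a := by
  rcases eq_or_ne a ρ with rfl | ha
  · rw [if_pos rfl, min_eq_right (by linarith), min_eq_left (by linarith), min_self]
    ring
  · rw [if_neg ha.symm]
    rcases le_abs.1 (h ha) with h | h
    · rw [min_eq_left (by linarith), min_eq_left (by linarith), min_eq_left (by linarith)]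
      ring
    · rw [min_eq_right (by linarith), min_eq_right (by linarith), min_eq_right (by linarith)]
      ring

theorem truncSum_add_add_truncSum_sub_add_count {ρ ε : 𝕜} (hε : 0 ≤ ε)
    (h : ∀ a ∈ M, a ≠ ρ → ε ≤ |a - ρ|) :
    truncSum M (ρ + ε) + truncSum M (ρ - ε) + M.count ρ * ε = 2 * truncSum M ρ := by
  induction M using Multiset.induction_on with
  | empty => simp [truncSum]
  | cons b M ih =>
    rw [Multiset.forall_mem_cons] at h
    have hb := min_add_add_min_sub_add_ite hε h.1
    have hM := ih h.2
    simp only [truncSum_cons, Multiset.count_cons]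
    split_ifs at hb ⊢ <;> push_cast <;> linarith

theorem count_eq_of_truncSum_eq (h : ∀ σ, 0 < σ → truncSum M σ = truncSum N σ) {ρ : 𝕜}
    (hρ : 0 < ρ) : M.count ρ = N.count ρ := by
  obtain ⟨ε, hε, hερ, hsep⟩ := exists_pos_le_forall_le_abs_sub (M + N) ρ (half_pos hρ)
  have hM := truncSum_add_add_truncSum_sub_add_count hε.le fun a ha =>
    hsep a (Multiset.mem_add.2 (.inl ha))
  have hN := truncSum_add_add_truncSum_sub_add_count hε.le fun a ha =>
    hsep a (Multiset.mem_add.2 (.inr ha))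
  rw [h ρ hρ, h (ρ + ε) (by linarith), h (ρ - ε) (by linarith), ← hN, add_right_inj] at hM
  exact_mod_cast mul_right_cancel₀ hε.ne' hM

theorem forall_truncSum_eq_iff_forall_count_eq (hM : ∀ a ∈ M, 0 ≤ a) (hN : ∀ a ∈ N, 0 ≤ a) :
    (∀ ρ, 0 < ρ → truncSum M ρ = truncSum N ρ) ↔ ∀ ρ, 0 < ρ → M.count ρ = N.count ρ := by
  refine ⟨fun h ρ => count_eq_of_truncSum_eq h, fun h ρ hρ => ?_⟩
  rw [← truncSum_filter_pos hM hρ.le, filter_pos_eq_of_count_eq h, truncSum_filter_pos hN hρ.le]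

end TruncatedSums

section RootValuations

open Polynomial

variable {L : Type*} [Field L] (w : AddValuation L (WithTop ℚ)) {p : L[X]}

/-- The valuations of the roots of `p`, with multiplicity. A root equal to `0` would get the junk
value `0` instead of `∞`, so this is only meaningful if `p` has a nonzero constant coefficient. -/
noncomputable def rootValuations (p : L[X]) : Multiset ℚ :=
  p.roots.map fun α => (w α).untopD 0

variable {w}

theorem map_coe_rootValuations (hp : p.coeff 0 ≠ 0) :
    (rootValuations w p).map WithTop.some = p.roots.map w := by
  rw [rootValuations, Multiset.map_map]
  refine Multiset.map_congr rfl fun α hα => ?_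
  have hwα : w α ≠ ⊤ := fun hw => hp <| (coeff_zero_eq_eval_zero p).trans <| by
    simpa only [w.top_iff.1 hw, IsRoot.def] using isRoot_of_mem_roots hα
  obtain ⟨a, ha⟩ := WithTop.ne_top_iff_exists.1 hwα
  rw [Function.comp_apply, ← ha, WithTop.untopD_coe]

theorem gaussValuation_eq_truncSum_rootValuations (hm : p.Monic) (hs : p.Splits)
    (hp : p.coeff 0 ≠ 0) (ρ : ℚ) :
    gaussValuation w (ρ : WithTop ℚ) p = truncSum (rootValuations w p) ρ :=
  calc gaussValuation w (ρ : WithTop ℚ) p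
      = (p.roots.map fun α => min (ρ : WithTop ℚ) (w α)).sum := by
        rw [← gaussValuation_multiset_prod_X_sub_C, ← hs.eq_prod_roots_of_monic hm]
    _ = truncSum (p.roots.map w) (ρ : WithTop ℚ) := by
        rw [truncSum, Multiset.map_map]
        rfl
    _ = truncSum (rootValuations w p) ρ := by rw [← map_coe_rootValuations hp, truncSum_map_coe]

theorem nonneg_of_mem_rootValuations (hm : p.Monic) (hs : p.Splits) (hp : p.coeff 0 ≠ 0)
    (hint : ∀ j, 0 ≤ w (p.coeff j)) {a : ℚ} (ha : a ∈ rootValuations w p) : 0 ≤ a := by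
  refine nonneg_of_truncSum_zero_nonneg (WithTop.coe_le_coe.1 ?_) ha
  rw [← gaussValuation_eq_truncSum_rootValuations hm hs hp, le_gaussValuation_iff]
  simpa using hint

end RootValuations

section RootEquivalence

open Polynomial ConvergentSeries

variable {L : Type} [Field L] [Algebra ConvergentSeriesField L] {w : AddValuation L (WithTop ℚ)}
  {f g : ConvergentSeries[X]}

theorem injective_algebraMap_comp_algebraMap :
    Function.Injective ((algebraMap ConvergentSeriesField L).comp
      (algebraMap ConvergentSeries ConvergentSeriesField)) :=
  (algebraMap ConvergentSeriesField L).injective.comp (IsFractionRing.injective ConvergentSeries _)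

theorem monic_overField (hf : f ∈ monicU) : (overField L f).Monic := hf.1.map _

theorem coeff_zero_overField_ne_zero (hf : f ∈ monicU) : (overField L f).coeff 0 ≠ 0 := by
  rw [overField, coeff_map, map_ne_zero_iff _ injective_algebraMap_comp_algebraMap]
  exact coeff_zero_ne_zero_of_mem_monicU hf

theorem ExtendsAdic.comap_eq_orderVal (hw : ExtendsAdic w) :
    w.comap ((algebraMap ConvergentSeriesField L).comp
      (algebraMap ConvergentSeries ConvergentSeriesField)) = orderVal :=
  AddValuation.ext fun a => (hw a).trans (orderVal_eq a).symm

theorem ExtendsAdic.gaussValuation_orderVal (hw : ExtendsAdic w) (hf : f ∈ monicU)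
    (hs : (overField L f).Splits) (ρ : ℚ) :
    gaussValuation orderVal (ρ : WithTop ℚ) f = truncSum (rootValuations w (overField L f)) ρ := by
  rw [← hw.comap_eq_orderVal, ← gaussValuation_map]
  exact gaussValuation_eq_truncSum_rootValuations (monic_overField hf) hs
    (coeff_zero_overField_ne_zero hf) ρ

theorem rootCount_eq_count_rootValuations (hf : f ∈ monicU) (ρ : ℚ) :
    rootCount w f ρ = (rootValuations w (overField L f)).count ρ := by
  rw [rootCount, ← map_coe_rootValuations (coeff_zero_overField_ne_zero hf),
    Multiset.count_map_eq_count' _ _ WithTop.coe_injective]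

theorem card_rootValuations_overField (hf : f ∈ monicU) (hs : (overField L f).Splits) :
    (rootValuations w (overField L f)).card = f.natDegree := by
  rw [rootValuations, Multiset.card_map, ← hs.natDegree_eq_card_roots, overField,
    hf.1.natDegree_map]

theorem ExtendsAdic.nonneg_of_mem_rootValuations (hw : ExtendsAdic w) (hf : f ∈ monicU)
    (hs : (overField L f).Splits) : ∀ a ∈ rootValuations w (overField L f), 0 ≤ a := by
  refine fun a => _root_.nonneg_of_mem_rootValuations (monic_overField hf) hs
    (coeff_zero_overField_ne_zero hf) fun j => ?_
  rw [overField, coeff_map, RingHom.comp_apply, hw]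
  exact WithTop.monotone_map_iff.2 Nat.mono_cast bot_le

theorem ExtendsAdic.newtonPolygon_eq_iff (hw : ExtendsAdic w) (hf : f ∈ monicU) (hg : g ∈ monicU)
    (hfs : (overField L f).Splits) (hgs : (overField L g).Splits) :
    newtonPolygon f = newtonPolygon g ↔ ∀ ρ : ℚ, 0 < ρ → rootCount w f ρ = rootCount w g ρ := by
  simp only [newtonPolygon_eq_iff_gaussValuation, rootCount_eq_count_rootValuations, hf, hg,
    hw.gaussValuation_orderVal hf hfs, hw.gaussValuation_orderVal hg hgs, WithTop.coe_inj]
  exact forall_truncSum_eq_iff_forall_count_eq (hw.nonneg_of_mem_rootValuations hf hfs)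
    (hw.nonneg_of_mem_rootValuations hg hgs)

theorem ExtendsAdic.forall_rootCount_eq_iff (hw : ExtendsAdic w) (hf : f ∈ monicU)
    (hg : g ∈ monicU) (hfs : (overField L f).Splits) (hgs : (overField L g).Splits) :
    (∀ ρ, rootCount w f ρ = rootCount w g ρ) ↔
      newtonPolygon f = newtonPolygon g ∧ f.natDegree = g.natDegree := by
  rw [hw.newtonPolygon_eq_iff hf hg hfs hgs, ← card_rootValuations_overField (w := w) hf hfs,
    ← card_rootValuations_overField (w := w) hg hgs]
  simp only [rootCount_eq_count_rootValuations, hf, hg]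
  refine ⟨fun h => ⟨fun ρ _ => h ρ, congrArg _ (Multiset.ext.2 h)⟩, fun ⟨hpos, hcard⟩ ρ => ?_⟩
  rw [eq_of_count_eq_of_card_eq (hw.nonneg_of_mem_rootValuations hf hfs)
    (hw.nonneg_of_mem_rootValuations hg hgs) hpos hcard]

theorem exists_common_splitting_extension (hf : f ∈ monicU) (hg : g ∈ monicU) :
    ∃ (L : Type) (_ : Field L) (_ : Algebra ConvergentSeriesField L)
      (_ : FiniteDimensional ConvergentSeriesField L) (_ : IsGalois ConvergentSeriesField L)
      (w : AddValuation L (WithTop ℚ)),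
      ExtendsAdic w ∧ (overField L f).Splits ∧ (overField L g).Splits := by
  obtain ⟨L, _, _, _, _, w, hw, hs⟩ := exists_splitting_extension (f * g)
  rw [overField, Polynomial.map_mul] at hs
  have h0 : overField L f * overField L g ≠ 0 :=
    mul_ne_zero (monic_overField hf).ne_zero (monic_overField hg).ne_zero
  exact ⟨L, _, _, inferInstance, inferInstance, w, hw, hs.of_dvd h0 (dvd_mul_right _ _),
    hs.of_dvd h0 (dvd_mul_left _ _)⟩

theorem posRootEquiv_iff (hf : f ∈ monicU) (hg : g ∈ monicU) :
    PosRootEquiv f g ↔ newtonPolygon f = newtonPolygon g := by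
  constructor
  · intro h
    obtain ⟨L, _, _, _, _, w, hw, hfs, hgs⟩ := exists_common_splitting_extension hf hg
    exact (hw.newtonPolygon_eq_iff hf hg hfs hgs).2 fun ρ hρ => h ρ hρ L w hw hfs hgs
  · exact fun h ρ hρ L _ _ _ _ w hw hfs hgs => (hw.newtonPolygon_eq_iff hf hg hfs hgs).1 h ρ hρ

theorem rootEquiv_iff (hf : f ∈ monicU) (hg : g ∈ monicU) :
    RootEquiv f g ↔ newtonPolygon f = newtonPolygon g ∧ f.natDegree = g.natDegree := by
  constructor
  · intro h
    obtain ⟨L, _, _, _, _, w, hw, hfs, hgs⟩ := exists_common_splitting_extension hf hg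
    exact (hw.forall_rootCount_eq_iff hf hg hfs hgs).1 fun ρ => h ρ L w hw hfs hgs
  · exact fun h ρ L _ _ _ _ w hw hfs hgs => (hw.forall_rootCount_eq_iff hf hg hfs hgs).2 h ρ

end RootEquivalence

section Weierstrass

open Polynomial ConvergentSeries

variable {f g : ConvergentSeries[X]}

theorem weierstrassU_le_monicU : weierstrassU ≤ monicU := fun _ hf => hf.1

theorem coeff_atZero (f : ConvergentSeries[X]) (j : ℕ) :
    (atZero f).coeff j = PowerSeries.coeff 0 (f.coeff j : ℂ⟦X⟧) := by
  rw [atZero, coeff_map, PowerSeries.coeff_zero_eq_constantCoeff_apply]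
  rfl

theorem zero_mem_newtonSupport_iff (hf : f ∈ weierstrassU) {j : ℕ} :
    (0, j) ∈ newtonSupport f ↔ j = f.natDegree := by
  rw [mem_newtonSupport, ← coeff_atZero, hf.2, coeff_X_pow]
  simp

theorem natDegree_le_of_newtonPolygon_eq (hf : f ∈ weierstrassU) (hg : g ∈ weierstrassU)
    (h : newtonPolygon f = newtonPolygon g) : g.natDegree ≤ f.natDegree := by
  have hfmem := cast_mem_newtonRegion ((zero_mem_newtonSupport_iff hf).2 rfl)
  rw [← region_newtonPolygon, h, region_newtonPolygon, Nat.cast_zero] at hfmem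
  obtain ⟨n, hn, hnf⟩ := exists_zero_fst_mem_of_mem_newtonRegion hfmem
  rw [← (zero_mem_newtonSupport_iff hg).1 hn]
  exact_mod_cast hnf

theorem natDegree_eq_of_newtonPolygon_eq (hf : f ∈ weierstrassU) (hg : g ∈ weierstrassU)
    (h : newtonPolygon f = newtonPolygon g) : f.natDegree = g.natDegree :=
  (natDegree_le_of_newtonPolygon_eq hg hf h.symm).antisymm
    (natDegree_le_of_newtonPolygon_eq hf hg h)

/-- The sum of the monomials `z₁ ^ i * z₂ ^ j` over `(i, j) ∈ T`. -/
noncomputable def polynomialOfExponents (T : Finset (ℕ × ℕ)) : ConvergentSeries[X] :=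
  ∑ A ∈ T, monomial A.2 (z ^ A.1)

variable {T : Finset (ℕ × ℕ)} {m n : ℕ}

theorem coeff_coeff_polynomialOfExponents (T : Finset (ℕ × ℕ)) (i j : ℕ) :
    PowerSeries.coeff i ((polynomialOfExponents T).coeff j : ℂ⟦X⟧) =
      if (i, j) ∈ T then 1 else 0 := by
  have hterm (A : ℕ × ℕ) :
      PowerSeries.coeff i ((monomial A.2 (z ^ A.1)).coeff j : ℂ⟦X⟧) =
        if (i, j) = A then 1 else 0 := by
    simp only [coeff_monomial, Prod.ext_iff]
    split_ifs <;> simp_all [coe_z, PowerSeries.coeff_X_pow]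
  simp_rw [polynomialOfExponents, finsetSum_coeff, AddSubmonoidClass.coe_finsetSum, map_sum,
    hterm, Finset.sum_ite_eq]

theorem newtonSupport_polynomialOfExponents (T : Finset (ℕ × ℕ)) :
    newtonSupport (polynomialOfExponents T) = T := by
  ext ⟨i, j⟩
  simp [mem_newtonSupport, coeff_coeff_polynomialOfExponents]

theorem coeff_polynomialOfExponents_of_le (hT : IsAntichain (· ≤ ·) (T : Set (ℕ × ℕ)))
    (hn : (0, n) ∈ T) {j : ℕ} (hj : n ≤ j) :
    (polynomialOfExponents T).coeff j = if j = n then 1 else 0 := by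
  refine Subtype.ext (PowerSeries.ext fun i => ?_)
  have hmem : (i, j) ∈ T ↔ i = 0 ∧ j = n :=
    ⟨fun hij => (Prod.mk.inj (hT.eq hn hij ⟨i.zero_le, hj⟩)).imp Eq.symm Eq.symm,
      by rintro ⟨rfl, rfl⟩; exact hn⟩
  rw [coeff_coeff_polynomialOfExponents]
  split_ifs <;> simp_all [PowerSeries.coeff_one]

theorem natDegree_polynomialOfExponents_le (hT : IsAntichain (· ≤ ·) (T : Set (ℕ × ℕ)))
    (hn : (0, n) ∈ T) : (polynomialOfExponents T).natDegree ≤ n :=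
  natDegree_le_iff_coeff_eq_zero.2 fun j hj => by
    rw [coeff_polynomialOfExponents_of_le hT hn hj.le, if_neg hj.ne']

theorem coeff_polynomialOfExponents_self (hT : IsAntichain (· ≤ ·) (T : Set (ℕ × ℕ)))
    (hn : (0, n) ∈ T) : (polynomialOfExponents T).coeff n = 1 := by
  rw [coeff_polynomialOfExponents_of_le hT hn le_rfl, if_pos rfl]

theorem natDegree_polynomialOfExponents (hT : IsAntichain (· ≤ ·) (T : Set (ℕ × ℕ)))
    (hn : (0, n) ∈ T) : (polynomialOfExponents T).natDegree = n :=
  natDegree_eq_of_le_of_coeff_ne_zero (natDegree_polynomialOfExponents_le hT hn) <| by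
    rw [coeff_polynomialOfExponents_self hT hn]
    exact one_ne_zero

theorem atZero_polynomialOfExponents (hT : IsAntichain (· ≤ ·) (T : Set (ℕ × ℕ)))
    (hn : (0, n) ∈ T) : atZero (polynomialOfExponents T) = X ^ n := by
  ext j
  have hmem : (0, j) ∈ T ↔ j = n := by
    refine ⟨fun hj => ?_, fun hj => hj ▸ hn⟩
    rcases le_total j n with h | h
    · exact congrArg Prod.snd (hT.eq hj hn ⟨le_rfl, h⟩)
    · exact congrArg Prod.snd (hT.eq hn hj ⟨le_rfl, h⟩).symm
  simp only [coeff_atZero, coeff_coeff_polynomialOfExponents, coeff_X_pow, hmem]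

theorem polynomialOfExponents_mem_weierstrassU (hT : IsAntichain (· ≤ ·) (T : Set (ℕ × ℕ)))
    (hm : (m, 0) ∈ T) (hn : (0, n) ∈ T) : polynomialOfExponents T ∈ weierstrassU := by
  refine ⟨⟨monic_of_natDegree_le_of_coeff_eq_one n (natDegree_polynomialOfExponents_le hT hn)
    (coeff_polynomialOfExponents_self hT hn), fun hX => ?_⟩, ?_⟩
  · have hcoeff := coeff_coeff_polynomialOfExponents T m 0
    simp [X_dvd_iff.1 hX, hm] at hcoeff
  · rw [natDegree_polynomialOfExponents hT hn, atZero_polynomialOfExponents hT hn]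

theorem exists_mem_weierstrassU_newtonPolygon_eq {N : NewtonPolygon} (hN : N ∈ NewtonPolygon.NU) :
    ∃ f ∈ weierstrassU, newtonPolygon f = N := by
  obtain ⟨S, hS⟩ := N.exists_support
  obtain ⟨T, hT, hTS⟩ := exists_finset_isAntichain_newtonRegion_eq S
  obtain ⟨⟨x, hx⟩, y, hy⟩ := hN
  rw [hS, ← hTS] at hx hy
  obtain ⟨m, hm⟩ := exists_zero_snd_mem_of_mem_newtonRegion hx
  obtain ⟨n, hn, -⟩ := exists_zero_fst_mem_of_mem_newtonRegion hy
  refine ⟨_, polynomialOfExponents_mem_weierstrassU hT hm hn, NewtonPolygon.ext ?_⟩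
  rw [region_newtonPolygon, newtonSupport_polynomialOfExponents, hTS, hS]

theorem newtonHom_comp_inclusion_surjective :
    Function.Surjective (newtonHom.comp (Submonoid.inclusion weierstrassU_le_monicU)) := by
  intro N
  obtain ⟨f, hf, h⟩ := exists_mem_weierstrassU_newtonPolygon_eq N.toAdd.2
  exact ⟨⟨f, hf⟩, congrArg Multiplicative.ofAdd (Subtype.ext h)⟩

theorem newtonHom_surjective : Function.Surjective newtonHom :=
  Function.Surjective.of_comp newtonHom_comp_inclusion_surjective

end Weierstrass

theorem mainTheorem10 :
    (∃ c : Con weierstrassU,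
      (∀ f g : weierstrassU, c f g ↔ RootEquiv (f : Polynomial ConvergentSeries) g) ∧
      ∃ e : c.Quotient ≃* Multiplicative NewtonPolygon.NU,
        ∀ f : weierstrassU, ((e (f : c.Quotient)).toAdd : NewtonPolygon) = newtonPolygon f) ∧
    (∃ c : Con monicU,
      (∀ f g : monicU, c f g ↔ RootEquiv (f : Polynomial ConvergentSeries) g) ∧
      ∃ φ : c.Quotient →* Multiplicative NewtonPolygon.NU,
        (∀ f : monicU, ((φ (f : c.Quotient)).toAdd : NewtonPolygon) = newtonPolygon f) ∧
        Function.Surjective φ) ∧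
    (∃ c : Con monicU,
      (∀ f g : monicU, c f g ↔ PosRootEquiv (f : Polynomial ConvergentSeries) g) ∧
      ∃ e : c.Quotient ≃* Multiplicative NewtonPolygon.NU,
        ∀ f : monicU, ((e (f : c.Quotient)).toAdd : NewtonPolygon) = newtonPolygon f) := by
  refine ⟨⟨Con.ker (newtonHom.comp (Submonoid.inclusion weierstrassU_le_monicU)), fun f g => ?_,
    Con.quotientKerEquivOfSurjective _ newtonHom_comp_inclusion_surjective, fun f => rfl⟩,
    ⟨Con.ker (newtonHom.prod degreeHom), fun f g => ?_,
      Con.lift _ newtonHom fun f g h => (Prod.ext_iff.1 ((Con.ker_rel _).1 h)).1, fun f => rfl, ?_⟩,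
    ⟨Con.ker newtonHom, fun f g => ?_,
      Con.quotientKerEquivOfSurjective _ newtonHom_surjective, fun f => rfl⟩⟩
  · rw [Con.ker_rel, rootEquiv_iff f.2.1 g.2.1]
    exact newtonHom_eq_iff.trans (iff_self_and.2 (natDegree_eq_of_newtonPolygon_eq f.2 g.2))
  · rw [Con.ker_rel, rootEquiv_iff f.2 g.2, MonoidHom.prod_apply, MonoidHom.prod_apply,
      Prod.ext_iff]
    exact and_congr newtonHom_eq_iff Multiplicative.ofAdd.injective.eq_iff
  · exact Con.lift_surjective_of_surjective _ newtonHom_surjective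
  · rw [Con.ker_rel, posRootEquiv_iff f.2 g.2]
    exact newtonHom_eq_iff
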